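/- Let $X$ be a $d$-dimensional random vector and $Y$ a real random variable on a probability space $(\Omega,\mathcal F,\mathbb P)$, let $\nu_X$ be the distribution of $X$, and let $\mathbb P[\,\cdot\mid X=x]$, $x\in\mathbb R^d$, be a regular conditional version of $\mathbb P$ given $X$. Let $\nu$ be a Borel probability measure on $\mathbb R^d$ that is absolutely continuous with respect to $\nu_X$. Define the probability measure $\mathbb P^\nu[A]=\int_{\mathbb R^d}\mathbb P[A\mid X=x]\,d\nu(x)$, $A\in\mathcal F$, and denote by $\mathbb E^\nu$ the expectation under $\mathbb P^\nu$. Let $\hat f:\mathbb R^d\to\mathbb R$ be Borel measurable, put $U^\nu=\mathbb E^\nu[(Y-\hat f(X))^2]$, and let $(X^n,Y^n)_{n\ge1}$ be independent random pairs, defined on some probability space (whose probability measure is again denoted by $\mathbb P^\nu$), each having the distribution of $(X,Y)$ under $\mathbb P^\nu$. Set $$U^\nu_N=\frac1N\sum_{n=1}^N\bigl(Y^n-\hat f(X^n)\bigr)^2,\qquad v^{U,\nu}_N=\frac1{N-1}\sum_{n=1}^N\Bigl(\bigl(Y^n-\hat f(X^n)\bigr)^2-U^\nu_N\Bigr)^2,$$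 and let $q_p$ denote the $p$-quantile of the standard normal distribution. If $\mathbb E^\nu Y^4<\infty$ and $\mathbb E^\nu|\hat f(X)|^4<\infty$, then for every $\alpha\in(0,1)$, $$\liminf_{N\to\infty}\mathbb P^\nu\left[\,\bigl|U^\nu-U^\nu_N\bigr|\le q_{1-\alpha}\sqrt{\frac{v^{U,\nu}_N}{N}}\,\right]\ge 1-2\alpha .$$ (For $\alpha\in(0,1/2)$ this says that $U^\nu_N\pm q_{1-\alpha}\sqrt{v^{U,\nu}_N/N}$ is an asymptotic two-sided confidence interval for $U^\nu$ with asymptotic coverage at least $1-2\alpha$; for $\alpha\ge 1/2$ the bound is trivial.) -/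

import Mathlib

open MeasureTheory ProbabilityTheory Filter
open scoped Topology

noncomputable section

namespace RegressionCI

/-- The `p`-quantile of a distribution `μ` on the real line: the smallest `x` whose cumulative
distribution function value is at least `p` (meaningful for `0 < p < 1`). -/
def quantile (μ : Measure ℝ) (p : ℝ) : ℝ :=
  sInf {x : ℝ | p ≤ cdf μ x}

/-- The `p`-quantile of the standard normal distribution. -/
def normalQuantile (p : ℝ) : ℝ :=
  quantile (gaussianReal 0 1) p

/-- The measure `A ↦ ∫ P[A | X = x] dν(x)`, where `κ x = P[· | X = x]` is a regular conditional
version of `P` given `X`. -/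
def distortedMeasure {E Ω : Type*} [MeasurableSpace E] [MeasurableSpace Ω]
    (κ : Kernel E Ω) (ν : Measure E) : Measure Ω :=
  ν.bind κ

/-- The mean squared distance `E[(Y - f(X))²]` under the measure `Q`. -/
def meanSqDist {E Ω : Type*} [MeasurableSpace Ω] (Q : Measure Ω) (X : Ω → E) (Y : Ω → ℝ)
    (f : E → ℝ) : ℝ :=
  ∫ ω, (Y ω - f (X ω)) ^ 2 ∂Q

/-- The Monte Carlo estimate `(1/N) ∑ (Yⁿ - f(Xⁿ))²` computed from the first `N` members of
the sample; the members are numbered from `0`. -/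
def estimator {E S : Type*} (Xs : ℕ → S → E) (Ys : ℕ → S → ℝ) (f : E → ℝ) (N : ℕ) (s : S) : ℝ :=
  1 / (N : ℝ) * ∑ n ∈ Finset.range N, (Ys n s - f (Xs n s)) ^ 2

/-- The sample variance `(1/(N-1)) ∑ ((Yⁿ - f(Xⁿ))² - U_N)²`, where `U_N` is the
Monte Carlo estimate. -/
def sampleVariance {E S : Type*} (Xs : ℕ → S → E) (Ys : ℕ → S → ℝ) (f : E → ℝ) (N : ℕ)
    (s : S) : ℝ :=
  1 / ((N : ℝ) - 1) *
    ∑ n ∈ Finset.range N, ((Ys n s - f (Xs n s)) ^ 2 - estimator Xs Ys f N s) ^ 2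

end RegressionCI

end

/-! The squared residuals are i.i.d. and, by the fourth moments, square integrable. The central
limit theorem governs the scaled error and the strong law the sample variance; Slutsky's theorem
joins them, and the portmanteau theorem bounds the liminf of the coverage below by the normal mass
of `|x| < q`, at least `1 - 2α` (`one_sub_two_mul_le_liminf_of_variance_ne_zero`). Zero variance is
separate: the residuals are then a.s. constant and the error vanishes. -/

namespace RegressionCI

section Quantile

/-- The distribution function at the `p`-quantile is at least `p`. -/
lemma le_cdf_quantile (μ : Measure ℝ) {p : ℝ} (hp1 : p < 1) :
    p ≤ cdf μ (quantile μ p) := by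
  have hne : {x : ℝ | p ≤ cdf μ x}.Nonempty := by
    obtain ⟨x, hx⟩ := ((tendsto_cdf_atTop μ).eventually (lt_mem_nhds hp1)).exists
    exact ⟨x, hx.le⟩
  have hright : Tendsto (cdf μ) (𝓝[>] (quantile μ p)) (𝓝 (cdf μ (quantile μ p))) :=
    ((cdf μ).right_continuous _).tendsto.mono_left (nhdsWithin_mono _ Set.Ioi_subset_Ici_self)
  -- By right continuity it suffices to bound the cdf at points beyond the infimum.
  refine ge_of_tendsto hright ?_
  filter_upwards [self_mem_nhdsWithin] with y hy
  obtain ⟨x, hx, hxy⟩ := exists_lt_of_csInf_lt hne hy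
  exact le_trans hx (monotone_cdf μ hxy.le)

lemma gaussianReal_real_Iic_neg (x : ℝ) :
    (gaussianReal 0 1).real (Set.Iic (-x)) = (gaussianReal 0 1).real (Set.Ici x) := by
  have h : (gaussianReal 0 1).map (fun y : ℝ => -y) = gaussianReal 0 1 := by
    simpa using gaussianReal_map_neg (μ := 0) (v := 1)
  conv_lhs => rw [← h]
  rw [map_measureReal_apply measurable_neg measurableSet_Iic]
  congr 1
  ext y
  simp

lemma gaussianReal_real_Ici (x : ℝ) :
    (gaussianReal 0 1).real (Set.Ici x) = 1 - cdf (gaussianReal 0 1) x := by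
  have := nullSingletonClass_gaussianReal (μ := 0) (v := 1) one_ne_zero
  rw [cdf_eq_real, ← probReal_compl_eq_one_sub measurableSet_Iic, Set.compl_Iic]
  exact measureReal_congr Ioi_ae_eq_Ici.symm

lemma cdf_gaussianReal_zero : cdf (gaussianReal 0 1) 0 = 1 / 2 := by
  have h := gaussianReal_real_Iic_neg 0
  rw [neg_zero, gaussianReal_real_Ici, ← cdf_eq_real] at h
  linarith

lemma normalQuantile_nonneg {p : ℝ} (hp : 1 / 2 < p) : 0 ≤ normalQuantile p := by
  refine Real.sInf_nonneg fun x hx => ?_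
  by_contra! hneg
  have h1 : p ≤ cdf (gaussianReal 0 1) x := hx
  have h2 := monotone_cdf (gaussianReal 0 1) hneg.le
  rw [cdf_gaussianReal_zero] at h2
  linarith

lemma one_sub_two_mul_le_gaussianReal_real_abs_lt {α : ℝ} (hα : α ∈ Set.Ioo (0 : ℝ) 1) :
    1 - 2 * α ≤ (gaussianReal 0 1).real {x | |x| < normalQuantile (1 - α)} := by
  set q := normalQuantile (1 - α) with hq
  have hcdf : 1 - α ≤ cdf (gaussianReal 0 1) q :=
    le_cdf_quantile _ (by linarith [hα.1])
  have hset : {x : ℝ | |x| < q} = (Set.Iic (-q) ∪ Set.Ici q)ᶜ := by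
    ext x
    simp [abs_lt]
  -- The union bound also covers `q < 0`, where the two tails overlap.
  have hunion := measureReal_union_le (μ := gaussianReal 0 1) (Set.Iic (-q)) (Set.Ici q)
  rw [gaussianReal_real_Iic_neg, gaussianReal_real_Ici] at hunion
  rw [hset, probReal_compl_eq_one_sub (measurableSet_Iic.union measurableSet_Ici)]
  linarith

end Quantile

section Sample

/-- The mean of the first `N` members of a sample. -/
noncomputable def sampleMean {S : Type*} (Z : ℕ → S → ℝ) (N : ℕ) (s : S) : ℝ :=
  1 / (N : ℝ) * ∑ n ∈ Finset.range N, Z n s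

/-- The unbiased sample variance of the first `N` members of a sample. -/
noncomputable def unbiasedVariance {S : Type*} (Z : ℕ → S → ℝ) (N : ℕ) (s : S) : ℝ :=
  1 / ((N : ℝ) - 1) * ∑ n ∈ Finset.range N, (Z n s - sampleMean Z N s) ^ 2

/-- Puts the variance in terms of empirical moments, to which the strong law applies. -/
lemma unbiasedVariance_eq {S : Type*} (Z : ℕ → S → ℝ) {N : ℕ} (hN : 1 < N) (s : S) :
    unbiasedVariance Z N s = (1 - (N : ℝ)⁻¹)⁻¹ *
      ((∑ n ∈ Finset.range N, Z n s ^ 2) / N - ((∑ n ∈ Finset.range N, Z n s) / N) ^ 2) := by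
  have h1 : (1 : ℝ) < N := by exact_mod_cast hN
  have h2 : (N : ℝ) - 1 ≠ 0 := by linarith
  have h3 : (N : ℝ) ≠ 0 := by linarith
  simp only [unbiasedVariance, sampleMean, sub_sq, Finset.sum_add_distrib,
    Finset.sum_sub_distrib, ← Finset.sum_mul, ← Finset.mul_sum, Finset.sum_const,
    Finset.card_range, nsmul_eq_mul]
  have h4 : (1 - (N : ℝ)⁻¹)⁻¹ = N / (N - 1) := by field_simp
  rw [h4]
  field_simp
  ring

/-- Dividing the estimation error by its standard error does not change the event that the
true mean lies in the confidence interval. -/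
lemma abs_sub_sampleMean_le_iff {S : Type*} {Z : ℕ → S → ℝ} {m c : ℝ} {N : ℕ} (hN : 0 < N) (s : S) :
    |m - sampleMean Z N s| ≤ c * √(unbiasedVariance Z N s / N) ↔
      |(√N)⁻¹ * (∑ n ∈ Finset.range N, Z n s - N * m)| - c * √(unbiasedVariance Z N s) ≤ 0 := by
  have hN' : (0 : ℝ) < N := by exact_mod_cast hN
  have hs : 0 < √(N : ℝ) := Real.sqrt_pos.2 hN'
  have h : (√N)⁻¹ * (∑ n ∈ Finset.range N, Z n s - N * m) =
      √N * (sampleMean Z N s - m) := by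
    have := Real.mul_self_sqrt hN'.le
    rw [sampleMean]
    field_simp
    rw [pow_two, this]
  rw [h, abs_mul, abs_of_pos hs, abs_sub_comm, Real.sqrt_div' _ hN'.le, ← mul_div_assoc,
    le_div_iff₀ hs, sub_nonpos, mul_comm]

variable {S : Type*} [MeasurableSpace S] {Q : Measure S} {Z : ℕ → S → ℝ}

lemma aemeasurable_unbiasedVariance (hZ : ∀ n, AEMeasurable (Z n) Q) (N : ℕ) :
    AEMeasurable (unbiasedVariance Z N) Q := by
  have hmean : AEMeasurable (sampleMean Z N) Q :=
    (Finset.aemeasurable_fun_sum _ fun n _ => hZ n).const_mul _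
  exact (Finset.aemeasurable_fun_sum _ fun n _ => ((hZ n).sub hmean).pow_const 2).const_mul _

variable [IsProbabilityMeasure Q]

lemma ae_tendsto_unbiasedVariance (hZ : MemLp (Z 0) 2 Q) (hindep : iIndepFun Z Q)
    (hident : ∀ n, IdentDistrib (Z n) (Z 0) Q Q) :
    ∀ᵐ s ∂Q, Tendsto (fun N => unbiasedVariance Z N s) atTop (𝓝 (Var[Z 0; Q])) := by
  have hmean := strong_law_ae_real Z (hZ.integrable (by norm_num))
    (fun i j hij => hindep.indepFun hij) hident
  have hsq := strong_law_ae_real (fun n s => Z n s ^ 2) hZ.integrable_sq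
    (fun i j hij => (hindep.indepFun hij).comp (measurable_id.pow_const 2)
      (measurable_id.pow_const 2))
    (fun n => (hident n).comp (u := fun x => x ^ 2) (by fun_prop))
  filter_upwards [hmean, hsq] with s h1 h2
  have h3 : Tendsto (fun N : ℕ => (1 - (N : ℝ)⁻¹)⁻¹) atTop (𝓝 1) := by
    simpa using (tendsto_const_nhds.sub (tendsto_inv_atTop_nhds_zero_nat (𝕜 := ℝ))).inv₀
      (a := (1 : ℝ) - 0) (by norm_num)
  have h4 := h3.mul (h2.sub (h1.pow 2))
  rw [one_mul] at h4
  rw [variance_eq_sub hZ]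
  refine h4.congr' ?_
  filter_upwards [eventually_gt_atTop 1] with N hN
  exact (unbiasedVariance_eq Z hN s).symm

lemma tendstoInMeasure_sqrt_unbiasedVariance (hZ : MemLp (Z 0) 2 Q) (hindep : iIndepFun Z Q)
    (hident : ∀ n, IdentDistrib (Z n) (Z 0) Q Q) :
    TendstoInMeasure Q (fun N s => √(unbiasedVariance Z N s)) atTop
      (fun _ => √(Var[Z 0; Q])) := by
  refine tendstoInMeasure_of_tendsto_ae (fun N => ?_) ?_
  · exact (aemeasurable_unbiasedVariance
      (fun n => (hident n).aemeasurable_fst) N).sqrt.aestronglyMeasurable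
  · filter_upwards [ae_tendsto_unbiasedVariance hZ hindep hident] with s hs
    exact hs.sqrt

/-- If the variance vanishes, the true mean almost surely lies in the confidence interval. -/
lemma prob_eq_one_of_variance_eq_zero (hZ : MemLp (Z 0) 2 Q)
    (hident : ∀ n, IdentDistrib (Z n) (Z 0) Q Q) (hvar : Var[Z 0; Q] = 0) {c : ℝ} (hc : 0 ≤ c)
    {N : ℕ} (hN : 0 < N) :
    Q.real {s | |∫ t, Z 0 t ∂Q - sampleMean Z N s| ≤ c * √(unbiasedVariance Z N s / N)} = 1 := by
  have hae : ∀ᵐ s ∂Q, ∀ n, Z n s = ∫ t, Z 0 t ∂Q := by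
    refine ae_all_iff.2 fun n => ?_
    have h := ae_eq_integral_of_variance_eq_zero ((hident n).memLp_iff.2 hZ)
      ((hident n).variance_eq.trans hvar)
    rwa [(hident n).integral_eq] at h
  rw [← probReal_univ (μ := Q)]
  refine measureReal_congr ?_
  filter_upwards [hae] with s hs
  refine propext (iff_true_intro ?_)
  have hN' : (N : ℝ) ≠ 0 := by positivity
  have h : sampleMean Z N s = ∫ t, Z 0 t ∂Q := by
    simp [sampleMean, hs, hN']
  change |∫ t, Z 0 t ∂Q - sampleMean Z N s| ≤ c * √(unbiasedVariance Z N s / N)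
  rw [h, sub_self, abs_zero]
  positivity

lemma one_sub_two_mul_le_liminf_of_variance_ne_zero (hZ : MemLp (Z 0) 2 Q)
    (hindep : iIndepFun Z Q) (hident : ∀ n, IdentDistrib (Z n) (Z 0) Q Q)
    (hvar : Var[Z 0; Q] ≠ 0) {α : ℝ} (hα : α ∈ Set.Ioo (0 : ℝ) 1) :
    1 - 2 * α ≤ liminf (fun N : ℕ => Q.real {s | |∫ t, Z 0 t ∂Q - sampleMean Z N s|
      ≤ normalQuantile (1 - α) * √(unbiasedVariance Z N s / N)}) atTop := by
  set q := normalQuantile (1 - α) with hq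
  set σ := √(Var[Z 0; Q]) with hσ
  have hσpos : 0 < σ := Real.sqrt_pos.2 ((variance_nonneg _ _).lt_of_ne' hvar)
  have hmeas n := (hident n).aemeasurable_fst
  have hlaw : HasLaw (fun x : ℝ => σ * x) (gaussianReal 0 Var[Z 0; Q].toNNReal)
      (gaussianReal 0 1) := by
    refine ⟨by fun_prop, ?_⟩
    rw [gaussianReal_map_const_mul]
    congr 1
    · simp
    · ext
      simp [hσ, Real.sq_sqrt, variance_nonneg]
  have hclt := tendstoInDistribution_inv_sqrt_mul_sum_sub hlaw hZ hindep hident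
  -- Taking a difference instead of a quotient avoids dividing by a sample deviation that may be
  -- zero.
  have hslutsky := hclt.continuous_comp_prodMk_of_tendstoInMeasure_const
    (g := fun p : ℝ × ℝ => |p.1| - q * p.2) (by fun_prop)
    (tendstoInMeasure_sqrt_unbiasedVariance hZ hindep hident)
    (fun N => (aemeasurable_unbiasedVariance hmeas N).sqrt)
  -- A lower bound needs an open set; the strict event lies inside the coverage event.
  have hopen := ProbabilityMeasure.le_liminf_measure_open_of_tendsto hslutsky.tendsto
    (isOpen_Iio (a := (0 : ℝ)))
  simp only [ProbabilityMeasure.coe_mk] at hopen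
  rw [Measure.map_apply_of_aemeasurable hslutsky.aemeasurable_limit measurableSet_Iio] at hopen
  have hlim : ENNReal.ofReal (1 - 2 * α) ≤ (gaussianReal 0 1)
      ((fun x : ℝ => |σ * x| - q * σ) ⁻¹' Set.Iio 0) := by
    rw [ENNReal.ofReal_le_iff_le_toReal (measure_ne_top _ _)]
    refine (one_sub_two_mul_le_gaussianReal_real_abs_lt hα).trans_eq ?_
    change (gaussianReal 0 1).real _ = (gaussianReal 0 1).real _
    congr 1
    ext x
    simp only [Set.mem_ofPred_eq, Set.mem_preimage, Set.mem_Iio, sub_neg, abs_mul,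
      abs_of_pos hσpos]
    rw [mul_comm q, mul_lt_mul_iff_right₀ hσpos]
  refine le_of_forall_lt fun b hb => ?_
  obtain ⟨b', hbb', hb'⟩ := exists_between hb
  refine hbb'.trans_le (le_liminf_of_le (isCoboundedUnder_ge_of_le atTop
    (fun N => measureReal_le_one)) ?_)
  -- `ENNReal.ofReal` is strictly monotone only towards positive values, so `b' ≤ 0` is split off.
  rcases le_or_gt b' 0 with h0 | h0
  · exact .of_forall fun N => h0.trans measureReal_nonneg
  have hlt := ((ENNReal.ofReal_lt_ofReal_iff (h0.trans hb')).2 hb').trans_le (hlim.trans hopen)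
  filter_upwards [eventually_lt_of_lt_liminf hlt, eventually_gt_atTop 0] with N hN hN0
  rw [Measure.map_apply_of_aemeasurable (hslutsky.forall_aemeasurable N) measurableSet_Iio] at hN
  refine (ENNReal.ofReal_le_iff_le_toReal (measure_ne_top _ _)).1 ?_
  refine hN.le.trans (measure_mono fun s hs => ?_)
  exact (abs_sub_sampleMean_le_iff hN0 s).2 (le_of_lt hs)

/-- Asymptotic coverage of the normal confidence interval for the mean of an independent,
identically distributed sample with finite variance. -/
theorem one_sub_two_mul_le_liminf_coverage (hZ : MemLp (Z 0) 2 Q)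
    (hindep : iIndepFun Z Q) (hident : ∀ n, IdentDistrib (Z n) (Z 0) Q Q)
    {α : ℝ} (hα : α ∈ Set.Ioo (0 : ℝ) 1) :
    1 - 2 * α ≤ liminf (fun N : ℕ => Q.real {s | |∫ t, Z 0 t ∂Q - sampleMean Z N s|
      ≤ normalQuantile (1 - α) * √(unbiasedVariance Z N s / N)}) atTop := by
  by_cases hvar : Var[Z 0; Q] = 0
  · refine le_liminf_of_le (isCoboundedUnder_ge_of_le atTop (fun N => measureReal_le_one)) ?_
    filter_upwards [eventually_gt_atTop 0] with N hN
    rcases le_or_gt (1 / 2) α with h | h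
    · exact le_trans (by linarith) measureReal_nonneg
    · rw [prob_eq_one_of_variance_eq_zero hZ hident hvar
        (normalQuantile_nonneg (by linarith)) hN]
      linarith [hα.1]
  · exact one_sub_two_mul_le_liminf_of_variance_ne_zero hZ hindep hident hvar hα

end Sample

/-- Rests on `(u - v)^4 ≤ 8 (u^4 + v^4)`, a convexity bound. -/
lemma memLp_two_sub_sq {Ω : Type*} [MeasurableSpace Ω] {μ : Measure Ω} {u v : Ω → ℝ}
    (hu : Measurable u) (hv : Measurable v) (hu4 : Integrable (fun ω => u ω ^ 4) μ)
    (hv4 : Integrable (fun ω => |v ω| ^ 4) μ) :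
    MemLp (fun ω => (u ω - v ω) ^ 2) 2 μ := by
  have hm : Measurable fun ω => (u ω - v ω) ^ 2 := (hu.sub hv).pow_const 2
  rw [memLp_two_iff_integrable_sq hm.aestronglyMeasurable]
  refine ((hu4.add hv4).const_mul 8).mono' (hm.pow_const 2).aestronglyMeasurable
    (.of_forall fun ω => ?_)
  rw [Real.norm_of_nonneg (by positivity), Pi.add_apply, (by decide : Even 4).pow_abs]
  nlinarith [sq_nonneg ((u ω) ^ 2 - (v ω) ^ 2), sq_nonneg ((u ω + v ω) ^ 2),
    mul_nonneg (sq_nonneg (u ω + v ω)) (sq_nonneg (u ω - v ω)),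
    sq_nonneg ((u ω - v ω) * (u ω + v ω))]

end RegressionCI

theorem mainTheorem5 {d : ℕ} {Ω : Type*} [MeasurableSpace Ω]
    (P : Measure Ω) [IsProbabilityMeasure P]
    (X : Ω → EuclideanSpace ℝ (Fin d)) (hX : Measurable X)
    (Y : Ω → ℝ) (hY : Measurable Y)
    -- `κ x = P[· | X = x]` is a regular conditional version of `P` given `X`
    (κ : Kernel (EuclideanSpace ℝ (Fin d)) Ω) [IsMarkovKernel κ]
    (hκ : HasCondDistrib id X κ P)
    (ν : Measure (EuclideanSpace ℝ (Fin d))) [IsProbabilityMeasure ν] (hν : ν ≪ P.map X)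
    (f : EuclideanSpace ℝ (Fin d) → ℝ) (hf : Measurable f)
    (hY4 : Integrable (fun ω => Y ω ^ 4) (RegressionCI.distortedMeasure κ ν))
    (hf4 : Integrable (fun ω => |f (X ω)| ^ 4) (RegressionCI.distortedMeasure κ ν))
    -- independent realizations of `(X, Y)` under the distorted measure
    {S : Type*} [MeasurableSpace S] (Q : Measure S) [IsProbabilityMeasure Q]
    (Xs : ℕ → S → EuclideanSpace ℝ (Fin d)) (Ys : ℕ → S → ℝ)
    (hindep : iIndepFun (fun n s => (Xs n s, Ys n s)) Q)
    (hident : ∀ n, IdentDistrib (fun s => (Xs n s, Ys n s)) (fun ω => (X ω, Y ω)) Q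
      (RegressionCI.distortedMeasure κ ν))
    (α : ℝ) (hα : α ∈ Set.Ioo (0 : ℝ) 1) :
    1 - 2 * α ≤ liminf (fun N : ℕ => Q.real {s |
      |RegressionCI.meanSqDist (RegressionCI.distortedMeasure κ ν) X Y f
          - RegressionCI.estimator Xs Ys f N s|
        ≤ RegressionCI.normalQuantile (1 - α)
          * √(RegressionCI.sampleVariance Xs Ys f N s / (N : ℝ))}) atTop := by

  -- Independence and equality in law pass from the pairs to the squared residuals through `T`.
  set T : EuclideanSpace ℝ (Fin d) × ℝ → ℝ := fun p => (p.2 - f p.1) ^ 2 with hT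
  have hTm : Measurable T := (measurable_snd.sub (hf.comp measurable_fst)).pow_const 2
  have hZ n : IdentDistrib (fun s => (Ys n s - f (Xs n s)) ^ 2) (fun ω => (Y ω - f (X ω)) ^ 2) Q
    (RegressionCI.distortedMeasure κ ν) := (hident n).comp hTm
  have hindepZ : iIndepFun (fun n s => (Ys n s - f (Xs n s)) ^ 2) Q :=
    hindep.comp (fun _ => T) (fun _ => hTm)
  have hmem := (hZ 0).memLp_iff.2
    (RegressionCI.memLp_two_sub_sq hY (hf.comp hX) hY4 hf4)
  have hmean : RegressionCI.meanSqDist (RegressionCI.distortedMeasure κ ν) X Y f =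
      ∫ s, (Ys 0 s - f (Xs 0 s)) ^ 2 ∂Q := (hZ 0).integral_eq.symm
  rw [hmean]
  exact RegressionCI.one_sub_two_mul_le_liminf_coverage hmem hindepZ
    (fun n => (hZ n).trans (hZ 0).symm) hα
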